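/- Let $m\ge 2$ and $n\ge 0$ be integers, let $p\in[1,\infty)$ and $\lambda\ge 0$. Let $\mathbb{B}^m=\{x\in\mathbb{R}^m:|x|\le 1\}$ be the closed Euclidean unit ball and $x_0(m)=(1,0,\ldots,0)\in\mathbb{R}^m$. For a weight $W:\Omega\to[0,\infty]$ on $\Omega\subset\mathbb{R}^m$ put $\|F\|_{L_{p,W}(\Omega)}=\left(\int_\Omega|F(x)|^pW(x)\,dx\right)^{1/p}$, and for a point $a\in\Omega$ and a vector space $B$ of complex-valued functions put $$\mathcal{N}_{a}\left(B,L_{p,W}(\Omega)\right)=\sup_{h\in B\setminus\{0\}}\frac{|h(a)|}{\|h\|_{L_{p,W}(\Omega)}}.$$ Let $\mathcal{P}_{n,m}$ be the set of all polynomials in $m$ real variables with complex coefficients and total degree at most $n$; let $D(m,x_0(m))$ be the group of all orthogonal transformations $\rho$ (proper and improper rotations about the origin) of $\mathbb{R}^m$ with $\rho x_0(m)=x_0(m)$; let $\mathcal{P}_{n,m}^{D(m,x_0(m))}$ be the set of all $P\in\mathcal{P}_{n,m}$ with $P(\rho x)=P(x)$ for all $\rho\in D(m,x_0(m))$ and $x\in\mathbb{R}^m$;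 and let $\mathcal{P}_{n,2,e}$ be the set of all $P(u,v)\in\mathcal{P}_{n,2}$ that are even in $v$. Then $$\mathcal{N}_{x_0(m)}\left(\mathcal{P}_{n,m},L_{p,(1-|x|^2)^{\lambda-1/2}}(\mathbb{B}^m)\right) =\mathcal{N}_{x_0(m)}\left(\mathcal{P}_{n,m}^{D(m,x_0(m))},L_{p,(1-|x|^2)^{\lambda-1/2}}(\mathbb{B}^m)\right)$$ $$=C_{17}\,\mathcal{N}_{x_0(2)}\left(\mathcal{P}_{n,2,e},L_{p,(1-u^2-v^2)^{\lambda-1/2}|v|^{m-2}}(\mathbb{B}^2)\right),$$ where $$C_{17}=C_{17}(m,p)=\left(\frac{\Gamma((m-1)/2)}{\pi^{(m-1)/2}}\right)^{1/p}.$$ -/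

import Mathlib

open MeasureTheory
open scoped ENNReal

noncomputable section

namespace BallNikolskii

/-- `ℝ^m` with its Euclidean norm. -/
abbrev E (m : ℕ) : Type := EuclideanSpace ℝ (Fin m)

/-- The point `x₀(m) = (1, 0, …, 0)` of `ℝ^m`. -/
def x₀ (m : ℕ) : E m := WithLp.toLp 2 (fun i : Fin m => if (i : ℕ) = 0 then (1 : ℝ) else 0)

/-- The closed unit ball `𝔹^m` of `ℝ^m`. -/
def unitBall (m : ℕ) : Set (E m) := Metric.closedBall (0 : E m) 1

/-- The norm of `L_{p,W}(Ω)`, `0 < p < ∞`, with values in `[0, ∞]`: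
`(∫_Ω |F(x)|^p W(x) dx)^{1/p}`. -/
def weightedNorm {m : ℕ} (p : ℝ) (W : E m → ℝ≥0∞) (Ω : Set (E m)) (F : E m → ℂ) : ℝ≥0∞ :=
  (∫⁻ x in Ω, ‖F x‖ₑ ^ p * W x) ^ (1 / p)

/-- The sharp constant `N_a(B, L_{p,W}(Ω))`: the supremum, over nonzero `h` in `B`, of
`|h(a)| / ‖h‖_{L_{p,W}(Ω)}`. -/
def sharpConst {m : ℕ} (a : E m) (B : Submodule ℂ (E m → ℂ)) (p : ℝ) (W : E m → ℝ≥0∞)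
    (Ω : Set (E m)) : ℝ≥0∞ :=
  ⨆ h ∈ {h : E m → ℂ | h ∈ B ∧ h ≠ 0}, ‖h a‖ₑ / weightedNorm p W Ω h

/-- The function on `ℝ^m` given by a polynomial with complex coefficients. -/
def polyFun (m : ℕ) : MvPolynomial (Fin m) ℂ →ₗ[ℂ] (E m → ℂ) where
  toFun P := fun x => MvPolynomial.eval (fun i => (x i : ℂ)) P
  map_add' P Q := by
    funext x
    simp
  map_smul' c P := by
    funext x
    simp

/-- `P_{n,m}`: the polynomials in `m` real variables, with complex coefficients, of total degree
at most `n`, as functions on `ℝ^m`. -/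
def polys (n m : ℕ) : Submodule ℂ (E m → ℂ) :=
  (MvPolynomial.restrictTotalDegree (Fin m) ℂ n).map (polyFun m)

/-- `D(m, x₀)`: the proper and improper rotations of `ℝ^m` about the origin that fix `x₀`. -/
def rotationsFixing (m : ℕ) : Subgroup (E m ≃ₗᵢ[ℝ] E m) where
  carrier := {ρ | ρ (x₀ m) = x₀ m}
  one_mem' := by
    simp
  mul_mem' := by
    intro a b ha hb
    change a (b (x₀ m)) = x₀ m
    rw [show b (x₀ m) = x₀ m from hb, show a (x₀ m) = x₀ m from ha]
  inv_mem' := by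
    intro a ha
    change a.symm (x₀ m) = x₀ m
    rw [LinearIsometryEquiv.symm_apply_eq]
    exact (show a (x₀ m) = x₀ m from ha).symm

/-- `P_{n,m}^D`: the polynomials of `P_{n,m}` that are invariant under the subgroup `D`. -/
def invPolys (n m : ℕ) (D : Subgroup (E m ≃ₗᵢ[ℝ] E m)) : Submodule ℂ (E m → ℂ) where
  carrier := {f | f ∈ polys n m ∧ ∀ ρ ∈ D, ∀ x, f (ρ x) = f x}
  zero_mem' := ⟨(polys n m).zero_mem, fun _ _ _ => rfl⟩
  add_mem' := by
    rintro f g ⟨hf, hf'⟩ ⟨hg, hg'⟩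
    refine ⟨(polys n m).add_mem hf hg, fun ρ hρ x => ?_⟩
    simp [hf' ρ hρ x, hg' ρ hρ x]
  smul_mem' := by
    rintro c f ⟨hf, hf'⟩
    refine ⟨(polys n m).smul_mem c hf, fun ρ hρ x => ?_⟩
    simp [hf' ρ hρ x]

/-- `P_{n,2,e}`: the polynomials `P(u, v)` of `P_{n,2}` that are even in the variable `v`. -/
def evenPolys (n : ℕ) : Submodule ℂ (E 2 → ℂ) where
  carrier := {f | f ∈ polys n 2 ∧ ∀ u v : ℝ, f !₂[u, -v] = f !₂[u, v]}
  zero_mem' := ⟨(polys n 2).zero_mem, fun _ _ => rfl⟩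
  add_mem' := by
    rintro f g ⟨hf, hf'⟩ ⟨hg, hg'⟩
    refine ⟨(polys n 2).add_mem hf hg, fun u v => ?_⟩
    simp [hf' u v, hg' u v]
  smul_mem' := by
    rintro c f ⟨hf, hf'⟩
    refine ⟨(polys n 2).smul_mem c hf, fun u v => ?_⟩
    simp [hf' u v]

/-- The weight `(1 - |x|²)^{lam - 1/2}` on `𝔹^m`, with values in `[0, ∞]`. -/
def ballWeight (m : ℕ) (lam : ℝ) (x : E m) : ℝ≥0∞ :=
  ENNReal.ofReal (1 - ‖x‖ ^ 2) ^ (lam - 1 / 2)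

/-- The weight `(1 - u² - v²)^{lam - 1/2} |v|^{m-2}` on `𝔹²`, with values in `[0, ∞]`. -/
def diskWeight (m : ℕ) (lam : ℝ) (x : E 2) : ℝ≥0∞ :=
  ENNReal.ofReal (1 - x 0 ^ 2 - x 1 ^ 2) ^ (lam - 1 / 2) *
    ENNReal.ofReal |x 1| ^ ((m : ℝ) - 2)

/-- The constant `(Γ((m-1)/2) / π^{(m-1)/2})^{1/p}`. -/
def C17 (m : ℕ) (p : ℝ) : ℝ :=
  (Real.Gamma (((m : ℝ) - 1) / 2) / Real.pi ^ (((m : ℝ) - 1) / 2)) ^ (1 / p)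

end BallNikolskii

end

/-! Write `m = k + 1` and `x = (u, rω)`, with `u` along the axis of `x₀` and `ω` on the unit sphere
of `ℝ^k`. Two linear maps link the spaces: `sphereMean` averages over `ω` and sends `polys` to
`evenPolys`; `axialLift` substitutes the distance to the axis for `v` and sends `evenPolys` to
`invPolys`. Both keep the value at `x₀`, which lies on the axis. Let `axialConst k` be half the area
of the sphere, half because the disk counts both signs of `v`. Since the ball weight is independent
of `ω` and `|v|^(m-2)` is the polar Jacobian of `ℝ^k`, lifting multiplies the `p`-th power of the
norm by exactly `axialConst k` (`lintegral_axialLift`). By Jensen, `axialConst k` times the `p`-th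
power of the norm of a spherical mean is at most that of the original polynomial
(`lintegral_sphereMean_le`). As `C17` is `axialConst k` to the power `-1/p`, the constants satisfy
`polys ≤ C17 * evenPolys ≤ invPolys ≤ polys`, so all are equal. -/

namespace BallNikolskii

open Metric Set

/-! ### Integration tools: polar coordinates, reflections, Jensen -/

/-- Polar coordinates for the lower Lebesgue integral. -/
theorem lintegral_polar {V : Type*} [NormedAddCommGroup V] [NormedSpace ℝ V] [MeasurableSpace V]
    [BorelSpace V] [FiniteDimensional ℝ V] [Nontrivial V] (μ : Measure V) [μ.IsAddHaarMeasure]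
    {G : V → ℝ≥0∞} (hG : Measurable G) :
    ∫⁻ x, G x ∂μ = ∫⁻ r in Ioi (0 : ℝ),
      (∫⁻ ω, G (r • (ω : V)) ∂μ.toSphere) * ENNReal.ofReal (r ^ (Module.finrank ℝ V - 1)) := by
  have hm : Measurable fun z : ℝ × sphere (0 : V) 1 => G (z.1 • (z.2 : V)) := by fun_prop
  have hI : Measurable fun r : ℝ => ∫⁻ ω, G (r • (ω : V)) ∂μ.toSphere :=
    hm.lintegral_prod_right'
  -- The origin is a null set, and its complement is homeomorphic to sphere × (0, ∞).
  calc ∫⁻ x, G x ∂μ = ∫⁻ x in ({0}ᶜ : Set V), G x ∂μ := by rw [restrict_compl_singleton]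
    _ = ∫⁻ x : ({0}ᶜ : Set V), G x ∂(μ.comap (↑)) :=
        (lintegral_subtype_comap (measurableSet_singleton _).compl G).symm
    _ = ∫⁻ z : sphere (0 : V) 1 × Ioi (0 : ℝ), G ((z.2 : ℝ) • (z.1 : V))
          ∂(μ.toSphere.prod (Measure.volumeIoiPow (Module.finrank ℝ V - 1))) := by
        rw [← μ.measurePreserving_homeomorphUnitSphereProd.lintegral_comp
          (by fun_prop)]
        refine lintegral_congr fun x => ?_
        have hx : ‖(x : V)‖ ≠ 0 := norm_ne_zero_iff.2 x.2
        simp [smul_smul, hx]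
    _ = ∫⁻ r : Ioi (0 : ℝ), ∫⁻ ω, G ((r : ℝ) • (ω : V)) ∂μ.toSphere
          ∂(Measure.volumeIoiPow (Module.finrank ℝ V - 1)) := by
        rw [lintegral_prod_symm' _ (by fun_prop)]
    _ = _ := by
        rw [Measure.volumeIoiPow, lintegral_withDensity_eq_lintegral_mul
          (f := fun r : Ioi (0 : ℝ) => ENNReal.ofReal ((r : ℝ) ^ (Module.finrank ℝ V - 1)))
          (g := fun r : Ioi (0 : ℝ) => ∫⁻ ω, G ((r : ℝ) • (ω : V)) ∂μ.toSphere) _ (by fun_prop)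
          (hI.comp measurable_subtype_coe)]
        simp only [Pi.mul_apply]
        rw [lintegral_subtype_comap measurableSet_Ioi (fun r : ℝ =>
          ENNReal.ofReal (r ^ (Module.finrank ℝ V - 1)) * ∫⁻ ω, G (r • (ω : V)) ∂μ.toSphere)]
        simp only [mul_comm]

/-- The spherical measure of `s` is a multiple of the volume of the cone over `s`, and volume is
invariant under reflection in the origin. -/
theorem measurePreserving_neg_toSphere {V : Type*} [NormedAddCommGroup V] [NormedSpace ℝ V]
    [MeasurableSpace V] [BorelSpace V] (μ : Measure V) [μ.IsNegInvariant] :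
    MeasurePreserving (fun ω : sphere (0 : V) 1 => -ω) μ.toSphere μ.toSphere := by
  have hn : Measurable fun ω : sphere (0 : V) 1 => -ω := continuous_neg.measurable
  refine ⟨hn, Measure.ext fun s hs => ?_⟩
  rw [Measure.map_apply hn hs, μ.toSphere_apply' (hn hs), μ.toSphere_apply' hs]
  congr 1
  rw [← Measure.measure_neg]
  congr 1
  ext x
  simp only [Set.mem_neg, Set.mem_smul, Set.mem_image, Set.mem_preimage]
  constructor
  · rintro ⟨r, hr, _, ⟨ω, hω, rfl⟩, h⟩
    exact ⟨r, hr, _, ⟨-ω, hω, rfl⟩, by simp [h]⟩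
  · rintro ⟨r, hr, _, ⟨ω, hω, rfl⟩, h⟩
    exact ⟨r, hr, _, ⟨-ω, by simpa using hω, rfl⟩, by simp [← h]⟩

theorem lintegral_even {g : ℝ → ℝ≥0∞} (hg : ∀ v, g (-v) = g v) :
    ∫⁻ v, g v = 2 * ∫⁻ v in Ioi (0 : ℝ), g v := by
  have h1 : ∫⁻ v in Iic (0 : ℝ), g v = ∫⁻ v in Ioi (0 : ℝ), g v := by
    have := (Measure.measurePreserving_neg (volume : Measure ℝ)).setLIntegral_comp_preimage_emb
      (MeasurableEquiv.neg ℝ).measurableEmbedding g (Iio 0)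
    rw [setLIntegral_congr Iio_ae_eq_Iic.symm, ← this]
    simp [hg]
  rw [← lintegral_add_compl g (measurableSet_Iic (a := (0 : ℝ))), compl_Iic, h1, two_mul]

/-- Jensen's inequality: on a probability space the `L¹` norm is at most the `L^p` norm. -/
theorem enorm_integral_rpow_le {α : Type*} [MeasurableSpace α] {ν : Measure α}
    [IsProbabilityMeasure ν] {f : α → ℂ} (hf : AEStronglyMeasurable f ν) {p : ℝ} (hp : 1 ≤ p) :
    ‖∫ a, f a ∂ν‖ₑ ^ p ≤ ∫⁻ a, ‖f a‖ₑ ^ p ∂ν := by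
  have hp0 : 0 < p := by linarith
  have h1 : ‖∫ a, f a ∂ν‖ₑ ≤ eLpNorm' f p ν :=
    (enorm_integral_le_lintegral_enorm f).trans <| by
      simpa [eLpNorm'_eq_lintegral_enorm] using
        eLpNorm'_le_eLpNorm'_of_exponent_le one_pos hp ν hf
  calc _ ≤ eLpNorm' f p ν ^ p := ENNReal.rpow_le_rpow h1 hp0.le
    _ = _ := (lintegral_rpow_enorm_eq_rpow_eLpNorm' hp0).symm

/-! ### Splitting off the axial coordinate -/

/-- The point of `ℝ^{k+1}` with first coordinate `u` and remaining coordinates `y`. -/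
def consPoint {k : ℕ} (u : ℝ) (y : E k) : E (k + 1) :=
  WithLp.toLp 2 (Fin.cons u y.ofLp : Fin (k + 1) → ℝ)

@[simp] theorem consPoint_zero {k : ℕ} (u : ℝ) (y : E k) : consPoint u y 0 = u := rfl

@[simp] theorem consPoint_succ {k : ℕ} (u : ℝ) (y : E k) (i : Fin k) :
    consPoint u y i.succ = y i := rfl

theorem norm_consPoint_sq {k : ℕ} (u : ℝ) (y : E k) :
    ‖consPoint u y‖ ^ 2 = u ^ 2 + ‖y‖ ^ 2 := by
  simp [EuclideanSpace.norm_sq_eq, Fin.sum_univ_succ]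

theorem measurePreserving_consPoint (k : ℕ) :
    MeasurePreserving (fun z : ℝ × E k => consPoint z.1 z.2) := by
  have h1 : MeasurePreserving (Prod.map id WithLp.ofLp : ℝ × E k → ℝ × (Fin k → ℝ)) :=
    (MeasurePreserving.id volume).prod (PiLp.volume_preserving_ofLp (Fin k))
  have h2 := (volume_preserving_piFinSuccAbove (fun _ : Fin (k + 1) => ℝ) 0).symm
  have h3 := PiLp.volume_preserving_toLp (Fin (k + 1))
  have := h3.comp (h2.comp h1)
  convert this using 1
  funext z
  simp [consPoint, MeasurableEquiv.piFinSuccAbove, Function.comp_def, Fin.insertNthEquiv]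

theorem continuous_consPoint (k : ℕ) : Continuous (fun z : ℝ × E k => consPoint z.1 z.2) := by
  refine (PiLp.continuous_toLp 2 _).comp (continuous_pi fun i => ?_)
  refine Fin.cases ?_ (fun j => ?_) i
  · exact continuous_fst
  · simp only [Fin.cons_succ]
    fun_prop

theorem measurePreserving_vec2 :
    MeasurePreserving (fun z : ℝ × ℝ => (!₂[z.1, z.2] : E 2)) :=
  (PiLp.volume_preserving_toLp (Fin 2)).comp (volume_preserving_finTwoArrow ℝ).symm

/-! ### Polynomial functions as sums of monomials -/

theorem polyFun_mem_polys {n m : ℕ} {P : MvPolynomial (Fin m) ℂ} (hP : P.totalDegree ≤ n) :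
    polyFun m P ∈ polys n m :=
  Submodule.mem_map_of_mem ((MvPolynomial.mem_restrictTotalDegree _ _ _).2 hP)

theorem exists_polyFun_of_mem_polys {n m : ℕ} {f : E m → ℂ} (hf : f ∈ polys n m) :
    ∃ P : MvPolynomial (Fin m) ℂ, P.totalDegree ≤ n ∧ polyFun m P = f := by
  obtain ⟨P, hP, rfl⟩ := hf
  exact ⟨P, (MvPolynomial.mem_restrictTotalDegree _ _ _).1 hP, rfl⟩

theorem polyFun_apply_eq_sum {m : ℕ} (P : MvPolynomial (Fin m) ℂ) (x : E m) :
    polyFun m P x = ∑ d ∈ P.support, P.coeff d * ∏ i, (x i : ℂ) ^ d i :=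
  MvPolynomial.eval_eq' _ _

theorem sum_le_of_mem_support {n m : ℕ} {P : MvPolynomial (Fin m) ℂ} (hP : P.totalDegree ≤ n)
    {d : Fin m →₀ ℕ} (hd : d ∈ P.support) : ∑ i, d i ≤ n := by
  have := (MvPolynomial.le_totalDegree hd).trans hP
  rwa [Finsupp.sum_fintype _ _ (fun _ => rfl)] at this

theorem continuous_of_mem_polys {n m : ℕ} {f : E m → ℂ} (hf : f ∈ polys n m) :
    Continuous f := by
  obtain ⟨P, -, rfl⟩ := exists_polyFun_of_mem_polys hf
  simp only [funext (polyFun_apply_eq_sum P)]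
  fun_prop

/-! ### Spherical means and axial lifts -/

/-- The mean of `h` over the sphere of radius `v` in the hyperplane where the first coordinate
is `u`, as a function of `(u, v)`. -/
noncomputable def sphereMean {k : ℕ} (h : E (k + 1) → ℂ) (x : E 2) : ℂ :=
  ⨍ ω, h (consPoint (x 0) (x 1 • (ω : E k))) ∂(volume : Measure (E k)).toSphere

/-- The function `x ↦ f (x₁, |(x₂, …)|)` on `ℝ^{k+1}`. -/
noncomputable def axialLift (k : ℕ) (f : E 2 → ℂ) (x : E (k + 1)) : ℂ :=
  f !₂[x 0, √(∑ i : Fin k, x i.succ ^ 2)]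

theorem x₀_succ (k : ℕ) : x₀ (k + 1) = consPoint 1 0 := by
  ext i
  refine Fin.cases ?_ (fun j => ?_) i <;> simp [x₀]

theorem x₀_two : x₀ 2 = !₂[1, 0] := by
  ext i
  fin_cases i <;> simp [x₀]

theorem sphereMean_x₀ {k : ℕ} [NeZero k] (h : E (k + 1) → ℂ) :
    sphereMean h (x₀ 2) = h (x₀ (k + 1)) := by
  have : NeZero (volume : Measure (E k)).toSphere := ⟨Measure.toSphere_ne_zero _⟩
  rw [sphereMean, x₀_two, x₀_succ]
  simp [average_const]

theorem axialLift_x₀ (k : ℕ) (f : E 2 → ℂ) : axialLift k f (x₀ (k + 1)) = f (x₀ 2) := by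
  rw [axialLift, x₀_two, x₀_succ]
  simp

theorem axialLift_consPoint (k : ℕ) (f : E 2 → ℂ) (u : ℝ) (y : E k) :
    axialLift k f (consPoint u y) = f !₂[u, ‖y‖] := by
  simp [axialLift, EuclideanSpace.norm_eq]

/-- At `(u, vω)` a monomial splits into a power of `u`, a power of `v` and a monomial in `ω`.
Averaging turns the last factor into the constant `c d`, and the degree in `(u, v)` is at most the
original one. -/
theorem sphereMean_mem_polys {n k : ℕ} {h : E (k + 1) → ℂ} (hh : h ∈ polys n (k + 1)) :
    sphereMean h ∈ polys n 2 := by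
  obtain ⟨P, hP, rfl⟩ := exists_polyFun_of_mem_polys hh
  let c (d : Fin (k + 1) →₀ ℕ) : ℂ :=
    ⨍ ω : sphere (0 : E k) 1, ∏ i : Fin k, ((ω : E k) i : ℂ) ^ d i.succ
      ∂(volume : Measure (E k)).toSphere
  have key : sphereMean (polyFun (k + 1) P) = ∑ d ∈ P.support, polyFun 2
      (MvPolynomial.C (P.coeff d * c d) * MvPolynomial.X 0 ^ d 0 *
        MvPolynomial.X 1 ^ (∑ i : Fin k, d i.succ)) := by
    funext x
    have h1 : ∀ ω : sphere (0 : E k) 1, polyFun (k + 1) P (consPoint (x 0) (x 1 • (ω : E k))) =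
        ∑ d ∈ P.support, (P.coeff d * (x 0 : ℂ) ^ d 0 * (x 1 : ℂ) ^ (∑ i : Fin k, d i.succ)) *
          ∏ i : Fin k, ((ω : E k) i : ℂ) ^ d i.succ := by
      intro ω
      rw [polyFun_apply_eq_sum]
      refine Finset.sum_congr rfl fun d _ => ?_
      simp [Fin.prod_univ_succ, mul_pow, Finset.prod_mul_distrib, Finset.prod_pow_eq_pow_sum]
      ring
    simp only [sphereMean, h1, Finset.sum_apply]
    rw [average, integral_finsetSum]
    · refine Finset.sum_congr rfl fun d _ => ?_
      rw [integral_const_mul]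
      simp only [polyFun, LinearMap.coe_mk, AddHom.coe_mk, map_mul, map_pow, MvPolynomial.eval_C,
        MvPolynomial.eval_X, c, average]
      ring
    · intro d _
      refine Continuous.integrable_of_hasCompactSupport ?_ (HasCompactSupport.of_compactSpace _)
      fun_prop
  rw [key]
  refine Submodule.sum_mem _ fun d hd => polyFun_mem_polys ?_
  have hd' := sum_le_of_mem_support hP hd
  rw [Fin.sum_univ_succ] at hd'
  refine le_trans ?_ hd'
  refine (MvPolynomial.totalDegree_mul _ _).trans (add_le_add ?_ ?_)
  · refine (MvPolynomial.totalDegree_mul _ _).trans ?_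
    rw [MvPolynomial.totalDegree_C]
    simp
  · simp

/-- The sign of `v` is absorbed by the substitution `ω ↦ -ω`. -/
theorem sphereMean_neg {k : ℕ} (h : E (k + 1) → ℂ) (u v : ℝ) :
    sphereMean h !₂[u, -v] = sphereMean h !₂[u, v] := by
  simp only [sphereMean, average_eq]
  congr 1
  rw [← (measurePreserving_neg_toSphere (volume : Measure (E k))).integral_comp
    (Homeomorph.neg (sphere (0 : E k) 1)).measurableEmbedding]
  simp

theorem sphereMean_mem_evenPolys {n k : ℕ} {h : E (k + 1) → ℂ} (hh : h ∈ polys n (k + 1)) :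
    sphereMean h ∈ evenPolys n :=
  ⟨sphereMean_mem_polys hh, sphereMean_neg h⟩

/-- Evenness removes the odd powers of `v`, and with them the square root: `v ^ (2 * j)` becomes `R
^ j`, of degree at most `2 * j`. -/
theorem axialLift_mem_polys {n : ℕ} (k : ℕ) {f : E 2 → ℂ} (hf : f ∈ evenPolys n) :
    axialLift k f ∈ polys n (k + 1) := by
  obtain ⟨hf, hev⟩ := hf
  obtain ⟨P, hP, rfl⟩ := exists_polyFun_of_mem_polys hf
  let R : MvPolynomial (Fin (k + 1)) ℂ := ∑ i : Fin k, MvPolynomial.X i.succ ^ 2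
  have hR : R.totalDegree ≤ 2 :=
    (MvPolynomial.totalDegree_finsetSum _ _).trans (Finset.sup_le fun i _ => by simp)
  have key : axialLift k (polyFun 2 P) = ∑ d ∈ P.support,
      if Even (d 1) then polyFun (k + 1)
        (MvPolynomial.C (P.coeff d) * MvPolynomial.X 0 ^ d 0 * R ^ (d 1 / 2)) else 0 := by
    funext x
    set v := √(∑ i : Fin k, x i.succ ^ 2) with hv
    have hv2 : (v : ℂ) ^ 2 = ∑ i : Fin k, (x i.succ : ℂ) ^ 2 := by
      have : v ^ 2 = ∑ i : Fin k, x i.succ ^ 2 :=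
        Real.sq_sqrt (Finset.sum_nonneg fun i _ => sq_nonneg _)
      exact_mod_cast congrArg (fun t : ℝ => (t : ℂ)) this
    -- Symmetrizing in `v` cancels the odd monomials termwise, so the odd coefficients of `P` need
    -- not be shown to vanish.
    have h1 : axialLift k (polyFun 2 P) x =
        (polyFun 2 P !₂[x 0, v] + polyFun 2 P !₂[x 0, -v]) / 2 := by
      rw [hev]
      simp [axialLift, hv]
    rw [h1, polyFun_apply_eq_sum, polyFun_apply_eq_sum, ← Finset.sum_add_distrib, Finset.sum_div,
      Finset.sum_apply]
    refine Finset.sum_congr rfl fun d _ => ?_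
    split_ifs with he
    · obtain ⟨j, hj⟩ := he
      simp [polyFun, R, hj, Fin.prod_univ_two, ← hv2, ← pow_mul, ← two_mul]
      ring
    · rw [Nat.not_even_iff_odd] at he
      simp [Fin.prod_univ_two, he.neg_pow]
  rw [key]
  refine Submodule.sum_mem _ fun d hd => ?_
  split_ifs with he
  · refine polyFun_mem_polys ?_
    have hd' := sum_le_of_mem_support hP hd
    rw [Fin.sum_univ_two] at hd'
    refine le_trans ?_ hd'
    refine (MvPolynomial.totalDegree_mul _ _).trans (add_le_add ?_ ?_)
    · refine (MvPolynomial.totalDegree_mul _ _).trans ?_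
      simp
    · refine (MvPolynomial.totalDegree_pow _ _).trans ?_
      calc d 1 / 2 * R.totalDegree ≤ d 1 / 2 * 2 := Nat.mul_le_mul_left _ hR
        _ ≤ d 1 := Nat.div_mul_le_self _ _
  · exact Submodule.zero_mem _

theorem inner_x₀ {k : ℕ} (x : E (k + 1)) : inner ℝ (x₀ (k + 1)) x = x 0 := by
  rw [x₀_succ]
  simp [PiLp.inner_apply, Fin.sum_univ_succ]

/-- An isometry fixing `x₀` preserves the norm and the inner product with `x₀`, hence the first
coordinate and the distance to the axis. -/
theorem axialLift_rotation (k : ℕ) (f : E 2 → ℂ) {ρ : E (k + 1) ≃ₗᵢ[ℝ] E (k + 1)}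
    (hρ : ρ ∈ rotationsFixing (k + 1)) (x : E (k + 1)) :
    axialLift k f (ρ x) = axialLift k f x := by
  have h0 : ρ x 0 = x 0 := by
    rw [← inner_x₀, ← inner_x₀]
    nth_rewrite 1 [← show ρ (x₀ (k + 1)) = x₀ (k + 1) from hρ]
    exact ρ.inner_map_map _ _
  have hs (y : E (k + 1)) : ∑ i : Fin k, y i.succ ^ 2 = ‖y‖ ^ 2 - y 0 ^ 2 := by
    simp [EuclideanSpace.norm_sq_eq, Fin.sum_univ_succ]
  simp only [axialLift, hs, h0, ρ.norm_map]

theorem axialLift_mem_invPolys {n : ℕ} (k : ℕ) {f : E 2 → ℂ} (hf : f ∈ evenPolys n) :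
    axialLift k f ∈ invPolys n (k + 1) (rotationsFixing (k + 1)) :=
  ⟨axialLift_mem_polys k hf, fun _ hρ x => axialLift_rotation k f hρ x⟩

/-! ### Weighted integrals in cylindrical coordinates -/

/-- The function `t ↦ (1 - t)^{lam - 1/2}` on `t ≤ 1`, extended by zero. -/
noncomputable def profile (lam t : ℝ) : ℝ≥0∞ :=
  -- The cutoff must be explicit: for `t > 1` the truncated base is `0`, and its power is `⊤` if
  -- `lam < 1/2` and `1` if `lam = 1/2`.
  if t ≤ 1 then ENNReal.ofReal (1 - t) ^ (lam - 1 / 2) else 0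

@[fun_prop] theorem measurable_profile (lam : ℝ) : Measurable (profile lam) :=
  Measurable.ite measurableSet_Iic (by fun_prop) measurable_const

/-- Moving the ball into the integrand leaves integrals over the whole space, to which the product
and polar formulas apply directly. -/
theorem lintegral_unitBall {m : ℕ} (lam : ℝ) (g : E m → ℝ≥0∞) :
    ∫⁻ x in unitBall m, g x * ENNReal.ofReal (1 - ‖x‖ ^ 2) ^ (lam - 1 / 2) =
      ∫⁻ x, g x * profile lam (‖x‖ ^ 2) := by
  rw [unitBall, ← lintegral_indicator isClosed_closedBall.measurableSet]
  refine lintegral_congr fun x => ?_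
  have h : x ∈ closedBall (0 : E m) 1 ↔ ‖x‖ ^ 2 ≤ 1 := by
    rw [mem_closedBall_zero_iff, sq_le_one_iff₀ (norm_nonneg x)]
  by_cases hx : ‖x‖ ^ 2 ≤ 1
  · rw [indicator_of_mem (h.2 hx), profile, if_pos hx]
  · rw [indicator_of_notMem (mt h.1 hx), profile, if_neg hx, mul_zero]

/-- The common weight in cylindrical coordinates `(u, r)`. -/
noncomputable def cylWeight (k : ℕ) (lam u r : ℝ) : ℝ≥0∞ :=
  profile lam (u ^ 2 + r ^ 2) * ENNReal.ofReal (r ^ (k - 1))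

/-- Tonelli in `(u, y)`, then polar coordinates in `y`; the weight leaves the `ω`-integral because
`‖x‖ ^ 2 = u ^ 2 + r ^ 2`. -/
theorem lintegral_ballWeight {k : ℕ} [NeZero k] (lam p : ℝ) {F : E (k + 1) → ℂ}
    (hF : Continuous F) :
    ∫⁻ x in unitBall (k + 1), ‖F x‖ₑ ^ p * ballWeight (k + 1) lam x =
      ∫⁻ u, ∫⁻ r in Ioi (0 : ℝ),
        (∫⁻ ω : sphere (0 : E k) 1, ‖F (consPoint u (r • (ω : E k)))‖ₑ ^ p
          ∂(volume : Measure (E k)).toSphere) * cylWeight k lam u r := by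
  have hm : Measurable fun x => ‖F x‖ₑ ^ p * profile lam (‖x‖ ^ 2) := by
    have := hF.measurable
    fun_prop
  have hc : Measurable fun z : ℝ × E k =>
      ‖F (consPoint z.1 z.2)‖ₑ ^ p * profile lam (‖consPoint z.1 z.2‖ ^ 2) :=
    hm.comp (continuous_consPoint k).measurable
  simp only [ballWeight]
  rw [lintegral_unitBall, ← (measurePreserving_consPoint k).lintegral_comp hm,
    Measure.volume_eq_prod, lintegral_prod _ hc.aemeasurable]
  refine lintegral_congr fun u => ?_
  have hu : Measurable fun y : E k =>
      ‖F (consPoint u y)‖ₑ ^ p * profile lam (‖consPoint u y‖ ^ 2) :=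
    hc.comp measurable_prodMk_left
  rw [lintegral_polar volume hu]
  refine lintegral_congr fun r => ?_
  have hn (ω : sphere (0 : E k) 1) : ‖consPoint u (r • (ω : E k))‖ ^ 2 = u ^ 2 + r ^ 2 := by
    simp [norm_consPoint_sq, norm_smul]
  have hFm : Measurable fun ω : sphere (0 : E k) 1 =>
      ‖F (consPoint u (r • (ω : E k)))‖ₑ ^ p := by
    have h1 : Continuous fun ω : sphere (0 : E k) 1 => F (consPoint u (r • (ω : E k))) :=
      hF.comp ((continuous_consPoint k).comp (by fun_prop :
        Continuous fun ω : sphere (0 : E k) 1 => (u, r • (ω : E k))))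
    exact h1.measurable.enorm.pow_const p
  simp only [hn]
  rw [lintegral_mul_const _ hFm, cylWeight, mul_assoc]
  simp

/-- Evenness in `v` gives the factor 2, and for `v = r > 0` the factor `|v|^(m-2)` is the Jacobian
`r ^ (k - 1)` in `cylWeight`. -/
theorem lintegral_diskWeight {k : ℕ} [NeZero k] (lam p : ℝ) {f : E 2 → ℂ}
    (hf : Continuous f) (hev : ∀ u v : ℝ, f !₂[u, -v] = f !₂[u, v]) :
    ∫⁻ x in unitBall 2, ‖f x‖ₑ ^ p * diskWeight (k + 1) lam x =
      2 * ∫⁻ u, ∫⁻ r in Ioi (0 : ℝ), ‖f !₂[u, r]‖ₑ ^ p * cylWeight k lam u r := by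
  have hnorm (x : E 2) : 1 - x 0 ^ 2 - x 1 ^ 2 = 1 - ‖x‖ ^ 2 := by
    simp [EuclideanSpace.norm_sq_eq, Fin.sum_univ_two, sub_sub]
  have hk : 1 ≤ k := NeZero.one_le
  -- Since `1 ≤ k`, the natural subtraction is not truncated.
  have hexp : (((k + 1 : ℕ) : ℝ) - 2) = ((k - 1 : ℕ) : ℝ) := by
    push_cast [hk]
    ring
  have habs (r : ℝ) : ENNReal.ofReal |r| ^ (((k + 1 : ℕ) : ℝ) - 2) =
      ENNReal.ofReal (|r| ^ (k - 1)) := by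
    rw [hexp, ENNReal.rpow_natCast, ENNReal.ofReal_pow (abs_nonneg r)]
  have h1 : ∫⁻ x in unitBall 2, ‖f x‖ₑ ^ p * diskWeight (k + 1) lam x =
      ∫⁻ x : E 2, (‖f x‖ₑ ^ p * ENNReal.ofReal (|x 1| ^ (k - 1))) * profile lam (‖x‖ ^ 2) := by
    rw [← lintegral_unitBall]
    refine lintegral_congr fun x => ?_
    rw [diskWeight, hnorm, habs]
    ring
  have hm : Measurable fun x : E 2 =>
      (‖f x‖ₑ ^ p * ENNReal.ofReal (|x 1| ^ (k - 1))) * profile lam (‖x‖ ^ 2) := by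
    have := hf.measurable
    fun_prop
  have hc : Measurable fun z : ℝ × ℝ => (‖f !₂[z.1, z.2]‖ₑ ^ p *
      ENNReal.ofReal (|(!₂[z.1, z.2] : E 2) 1| ^ (k - 1))) * profile lam (‖!₂[z.1, z.2]‖ ^ 2) :=
    hm.comp measurePreserving_vec2.measurable
  rw [h1, ← measurePreserving_vec2.lintegral_comp hm, Measure.volume_eq_prod,
    lintegral_prod _ hc.aemeasurable,
    ← lintegral_const_mul' _ _ (by simp)]
  refine lintegral_congr fun u => ?_
  rw [lintegral_even]
  · congr 1
    refine setLIntegral_congr_fun measurableSet_Ioi fun r hr => ?_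
    simp only [EuclideanSpace.norm_sq_eq, Fin.sum_univ_two, cylWeight]
    simp [abs_of_pos (mem_Ioi.1 hr)]
    ring
  · intro v
    simp [EuclideanSpace.norm_sq_eq, Fin.sum_univ_two, hev]

/-! ### The constant and the comparison of norms -/

/-- The ratio between the ball and disk integrals of an axially symmetric function. -/
noncomputable def axialConst (k : ℕ) : ℝ≥0∞ :=
  (volume : Measure (E k)).toSphere univ / 2

/-- The sphere has area `k` times the volume of the unit ball of `ℝ^k`, and `Γ(k/2 + 1) = (k/2)
Γ(k/2)` cancels both `k` and the 2. -/
theorem axialConst_eq (k : ℕ) [NeZero k] :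
    axialConst k = ENNReal.ofReal (Real.pi ^ ((k : ℝ) / 2) / Real.Gamma ((k : ℝ) / 2)) := by
  have hk : (0 : ℝ) < k := by exact_mod_cast NeZero.pos k
  have hG : 0 < Real.Gamma ((k : ℝ) / 2) := Real.Gamma_pos_of_pos (by positivity)
  rw [axialConst, Measure.toSphere_apply_univ, EuclideanSpace.volume_ball]
  simp only [Fintype.card_fin, finrank_euclideanSpace, ENNReal.ofReal_one, one_pow, one_mul]
  rw [← ENNReal.ofReal_natCast, ← ENNReal.ofReal_mul hk.le,
    show (2 : ℝ≥0∞) = ENNReal.ofReal 2 by simp, ← ENNReal.ofReal_div_of_pos two_pos]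
  congr 1
  rw [Real.Gamma_add_one (by positivity), Real.sqrt_eq_rpow, ← Real.rpow_natCast,
    ← Real.rpow_mul Real.pi_pos.le, show (1 / 2 * (k : ℝ)) = k / 2 by ring]
  field_simp

theorem axialConst_ne_zero (k : ℕ) [NeZero k] : axialConst k ≠ 0 :=
  ENNReal.div_ne_zero.2
    ⟨mt Measure.measure_univ_eq_zero.1 (Measure.toSphere_ne_zero _), ENNReal.ofNat_ne_top⟩

theorem axialConst_ne_top (k : ℕ) : axialConst k ≠ ⊤ :=
  ENNReal.div_ne_top (measure_ne_top _ _) two_ne_zero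

theorem ofReal_C17 (k : ℕ) [NeZero k] (p : ℝ) :
    ENNReal.ofReal (C17 (k + 1) p) = (axialConst k)⁻¹ ^ (1 / p) := by
  have hk : (0 : ℝ) < k := by exact_mod_cast NeZero.pos k
  have hG : 0 < Real.Gamma ((k : ℝ) / 2) := Real.Gamma_pos_of_pos (by positivity)
  have hpi : 0 < Real.pi ^ ((k : ℝ) / 2) := Real.rpow_pos_of_pos Real.pi_pos _
  rw [C17, axialConst_eq, ← ENNReal.ofReal_inv_of_pos (div_pos hpi hG), inv_div,
    ENNReal.ofReal_rpow_of_pos (div_pos hG hpi)]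
  simp

theorem toSphere_univ_mul (k : ℕ) (I : ℝ≥0∞) :
    (volume : Measure (E k)).toSphere univ * I = axialConst k * (2 * I) := by
  rw [axialConst, ← mul_assoc, ENNReal.div_mul_cancel two_ne_zero ENNReal.ofNat_ne_top]

/-- The lift is constant in `ω`, so each inner integral is the total area times the value of the
integrand on the disk. -/
theorem lintegral_axialLift {n k : ℕ} [NeZero k] (lam p : ℝ) {f : E 2 → ℂ}
    (hf : f ∈ evenPolys n) :
    ∫⁻ x in unitBall (k + 1), ‖axialLift k f x‖ₑ ^ p * ballWeight (k + 1) lam x =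
      axialConst k * ∫⁻ x in unitBall 2, ‖f x‖ₑ ^ p * diskWeight (k + 1) lam x := by
  rw [lintegral_ballWeight lam p (continuous_of_mem_polys (axialLift_mem_polys k hf)),
    lintegral_diskWeight lam p (continuous_of_mem_polys hf.1) hf.2, ← toSphere_univ_mul,
    ← lintegral_const_mul' _ _ (measure_ne_top _ _)]
  refine lintegral_congr fun u => ?_
  rw [← lintegral_const_mul' _ _ (measure_ne_top _ _)]
  refine setLIntegral_congr_fun measurableSet_Ioi fun r hr => ?_
  simp [axialLift_consPoint, norm_smul, abs_of_pos (mem_Ioi.1 hr)]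
  ring

theorem enorm_sphereMean_rpow_le {n k : ℕ} [NeZero k] {p : ℝ} (hp : 1 ≤ p) {h : E (k + 1) → ℂ}
    (hh : h ∈ polys n (k + 1)) (u r : ℝ) :
    (volume : Measure (E k)).toSphere univ * ‖sphereMean h !₂[u, r]‖ₑ ^ p ≤
      ∫⁻ ω : sphere (0 : E k) 1, ‖h (consPoint u (r • (ω : E k)))‖ₑ ^ p
        ∂(volume : Measure (E k)).toSphere := by
  set σ := (volume : Measure (E k)).toSphere
  have : NeZero σ := ⟨Measure.toSphere_ne_zero _⟩
  have hc : Continuous fun ω : sphere (0 : E k) 1 => h (consPoint u (r • (ω : E k))) :=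
    (continuous_of_mem_polys hh).comp ((continuous_consPoint k).comp (by fun_prop :
      Continuous fun ω : sphere (0 : E k) 1 => (u, r • (ω : E k))))
  -- The mean is the integral against the normalized measure, to which Jensen applies.
  have hJ := enorm_integral_rpow_le (ν := (σ univ)⁻¹ • σ) hc.aestronglyMeasurable hp
  rw [lintegral_smul_measure, smul_eq_mul] at hJ
  calc _ ≤ σ univ * ((σ univ)⁻¹ * ∫⁻ ω, ‖h (consPoint u (r • (ω : E k)))‖ₑ ^ p ∂σ) :=
        mul_le_mul_right hJ _
    _ = _ := by
        rw [← mul_assoc, ENNReal.mul_inv_cancel (NeZero.ne _) (measure_ne_top _ _), one_mul]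

theorem lintegral_sphereMean_le {n k : ℕ} [NeZero k] (lam : ℝ) {p : ℝ} (hp : 1 ≤ p)
    {h : E (k + 1) → ℂ} (hh : h ∈ polys n (k + 1)) :
    axialConst k * ∫⁻ x in unitBall 2, ‖sphereMean h x‖ₑ ^ p * diskWeight (k + 1) lam x ≤
      ∫⁻ x in unitBall (k + 1), ‖h x‖ₑ ^ p * ballWeight (k + 1) lam x := by
  have hs := sphereMean_mem_evenPolys hh
  rw [lintegral_ballWeight lam p (continuous_of_mem_polys hh),
    lintegral_diskWeight lam p (continuous_of_mem_polys hs.1) hs.2, ← toSphere_univ_mul,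
    ← lintegral_const_mul' _ _ (measure_ne_top _ _)]
  refine lintegral_mono fun u => ?_
  rw [← lintegral_const_mul' _ _ (measure_ne_top _ _)]
  refine lintegral_mono fun r => ?_
  rw [← mul_assoc]
  exact mul_le_mul_left (enorm_sphereMean_rpow_le hp hh u r) _

/-- The inverse of the product splits even when `I` is `0` or `⊤`, because `axialConst k` is
neither. -/
theorem C17_mul_div (k : ℕ) [NeZero k] {p : ℝ} (hp : 0 < p) (a I : ℝ≥0∞) :
    ENNReal.ofReal (C17 (k + 1) p) * (a / I ^ (1 / p)) = a / (axialConst k * I) ^ (1 / p) := by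
  have h0 : 0 ≤ 1 / p := by positivity
  rw [ofReal_C17 k p, ENNReal.inv_rpow, ENNReal.mul_rpow_of_nonneg _ _ h0,
    div_eq_mul_inv a, div_eq_mul_inv a, ENNReal.mul_inv]
  · ring
  · left
    simp [ENNReal.rpow_eq_zero_iff, axialConst_ne_zero, axialConst_ne_top]
  · left
    exact ENNReal.rpow_ne_top_of_nonneg h0 (axialConst_ne_top k)

/-! ### Comparison of the sharp constants -/

/-- Allowing `h = 0`, where the quotient is `0`, matters because the spherical mean of a nonzero
polynomial may vanish. -/
theorem le_sharpConst {m : ℕ} {a : E m} {B : Submodule ℂ (E m → ℂ)} (p : ℝ) (W : E m → ℝ≥0∞)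
    (Ω : Set (E m)) {h : E m → ℂ} (hB : h ∈ B) :
    ‖h a‖ₑ / weightedNorm p W Ω h ≤ sharpConst a B p W Ω := by
  by_cases h0 : h = 0
  · simp [h0]
  · exact le_iSup₂_of_le (f := fun h (_ : h ∈ {h : E m → ℂ | h ∈ B ∧ h ≠ 0}) =>
      ‖h a‖ₑ / weightedNorm p W Ω h) h ⟨hB, h0⟩ le_rfl

theorem sharpConst_mono {m : ℕ} (a : E m) {B B' : Submodule ℂ (E m → ℂ)} (hB : B ≤ B') (p : ℝ)
    (W : E m → ℝ≥0∞) (Ω : Set (E m)) : sharpConst a B p W Ω ≤ sharpConst a B' p W Ω :=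
  iSup₂_le fun _ hh => le_sharpConst p W Ω (hB hh.1)

theorem sharpConst_polys_le (n k : ℕ) [NeZero k] {p : ℝ} (lam : ℝ) (hp : 1 ≤ p) :
    sharpConst (x₀ (k + 1)) (polys n (k + 1)) p (ballWeight (k + 1) lam) (unitBall (k + 1)) ≤
      ENNReal.ofReal (C17 (k + 1) p) *
        sharpConst (x₀ 2) (evenPolys n) p (diskWeight (k + 1) lam) (unitBall 2) := by
  have hp0 : 0 < p := by linarith
  refine iSup₂_le fun h hh => ?_
  refine le_trans ?_ (mul_le_mul_right (le_sharpConst p (diskWeight (k + 1) lam) (unitBall 2)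
    (sphereMean_mem_evenPolys hh.1)) _)
  rw [weightedNorm, weightedNorm, C17_mul_div k hp0, sphereMean_x₀]
  refine ENNReal.div_le_div_left ?_ _
  exact ENNReal.rpow_le_rpow (lintegral_sphereMean_le lam hp hh.1) (by positivity)

theorem sharpConst_evenPolys_le (n k : ℕ) [NeZero k] {p : ℝ} (lam : ℝ) (hp : 0 < p) :
    ENNReal.ofReal (C17 (k + 1) p) *
        sharpConst (x₀ 2) (evenPolys n) p (diskWeight (k + 1) lam) (unitBall 2) ≤
      sharpConst (x₀ (k + 1)) (invPolys n (k + 1) (rotationsFixing (k + 1))) p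
        (ballWeight (k + 1) lam) (unitBall (k + 1)) := by
  rw [sharpConst, ENNReal.mul_iSup]
  refine iSup_le fun f => ?_
  rw [ENNReal.mul_iSup]
  refine iSup_le fun hf => ?_
  refine le_trans (le_of_eq ?_) (le_sharpConst p (ballWeight (k + 1) lam) (unitBall (k + 1))
    (axialLift_mem_invPolys k hf.1))
  rw [weightedNorm, weightedNorm, C17_mul_div k hp, axialLift_x₀, lintegral_axialLift lam p hf.1]

end BallNikolskii

theorem propositionP4p2 (n m : ℕ) (hm : 2 ≤ m) (p lam : ℝ) (hp : 1 ≤ p) (hlam : 0 ≤ lam) :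
    BallNikolskii.sharpConst (BallNikolskii.x₀ m) (BallNikolskii.polys n m) p
        (BallNikolskii.ballWeight m lam) (BallNikolskii.unitBall m)
      = BallNikolskii.sharpConst (BallNikolskii.x₀ m)
          (BallNikolskii.invPolys n m (BallNikolskii.rotationsFixing m)) p
          (BallNikolskii.ballWeight m lam) (BallNikolskii.unitBall m) ∧
    BallNikolskii.sharpConst (BallNikolskii.x₀ m)
        (BallNikolskii.invPolys n m (BallNikolskii.rotationsFixing m)) p
        (BallNikolskii.ballWeight m lam) (BallNikolskii.unitBall m)
      = ENNReal.ofReal (BallNikolskii.C17 m p) *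
          BallNikolskii.sharpConst (BallNikolskii.x₀ 2) (BallNikolskii.evenPolys n) p
            (BallNikolskii.diskWeight m lam) (BallNikolskii.unitBall 2) := by
  obtain ⟨k, rfl⟩ : ∃ k, m = k + 1 := ⟨m - 1, by omega⟩
  -- From `2 ≤ m`: the unit sphere of `ℝ^k` then has positive measure, so its averages are genuine
  -- means.
  have : NeZero k := ⟨by omega⟩
  have h1 := BallNikolskii.sharpConst_polys_le n k lam hp
  have h2 := BallNikolskii.sharpConst_evenPolys_le n k lam (by linarith : 0 < p)
  have h3 := BallNikolskii.sharpConst_mono (BallNikolskii.x₀ (k + 1))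
    (fun f (hf : f ∈ BallNikolskii.invPolys n (k + 1) (BallNikolskii.rotationsFixing (k + 1))) =>
      hf.1) p (BallNikolskii.ballWeight (k + 1) lam) (BallNikolskii.unitBall (k + 1))
  exact ⟨le_antisymm (h1.trans h2) h3, le_antisymm (h3.trans h1) h2⟩
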